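/- Let $r\in\mathbb N_0$, let $D\subset\mathbb R$ be open, let $f:D\to\mathbb R$ be of class $C^{r+1}$, let $T>0$, and let $y:[0,T]\to D$ be a solution of $\dot y(t)=f(y(t))$ on $[0,T]$ with $y(0)=y_0$. For $y\in D$ let $h\mapsto w(h,y)$ be the maximally extended solution of $$\frac{\partial w}{\partial h}(h,y)=\sum_{j=0}^{r}\frac{f^{(j)}(y)}{j!}\,w(h,y)^j,\qquad w(0,y)=0,$$ let $U_{\max}$ be the set of all $(h,y)\in\mathbb R\times D$ for which $w(h,y)$ exists, and define the one-step method $\Phi:U_{\max}\to\mathbb R$ by $\Phi(h,y)=y+w(h,y)$. (a) $\Phi$ is convergent of order $r+1$ for the approximation of $y$ on $[0,T]$: for every compact set $K\subset D$ whose interior contains $y([0,T])$ there exist $N_0\in\mathbb N$ and $M\ge 0$ such that for all integers $N\ge \max(N_0,1)$ and $h=T/N$ the values $y^{(N)}_0=y_0$, $y^{(N)}_{n+1}=\Phi(h,y^{(N)}_n)$, $n=0,\dots,N-1$, are well-defined (that is, $(h,y_n^{(N)})\in U_{\max}$ for $n<N$), all lie in the interior of $K$, and satisfy $$\max_{0\le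 n\le N}\bigl|y(nh)-y^{(N)}_n\bigr|\le M h^{r+1}.$$ (b) If $f$ coincides on $D$ with a polynomial of degree at most $r$, then $\Phi$ is exact: whenever $t,h\ge 0$ and $t+h\le T$, we have $(h,y(t))\in U_{\max}$ and $\Phi(h,y(t))=y(t+h)$. Moreover, for every step size $h\ge 0$ and every $n\in\mathbb N_0$ with $nh\le T$, the values $y_0$, $y_{m+1}=\Phi(h,y_m)$, $m<n$, are well-defined and $y_n=y(nh)$. (c) In particular, if $r=2$ and $f(x)=ax^2+bx+c$ on $D$ with real constants $a,b,c$ (an autonomous Riccati equation), then $\Phi$ is exact in the sense of (b). -/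

import Mathlib

open Set

namespace TaylorMethod

/-- The `r`-th order Taylor polynomial of `f` centred at `y`, as a function of the increment `w`:
`F(w, y) = ∑_{j=0}^{r} f^{(j)}(y) / j! * w ^ j`. -/
noncomputable def taylorField (f : ℝ → ℝ) (r : ℕ) (y w : ℝ) : ℝ :=
  ∑ j ∈ Finset.range (r + 1), iteratedDeriv j f y / (j.factorial : ℝ) * w ^ j

/-- `u` solves the initial value problem `u' = g(u)`, `u(0) = 0` on the open interval `J ∋ 0`
(order-connected open sets of reals are the open intervals, bounded or not). -/
structure IsSolutionOn (g : ℝ → ℝ) (J : Set ℝ) (u : ℝ → ℝ) : Prop where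
  isOpen : IsOpen J
  ordConnected : J.OrdConnected
  zero_mem : (0 : ℝ) ∈ J
  initial : u 0 = 0
  hasDerivAt : ∀ t ∈ J, HasDerivAt u (g (u t)) t

/-- The interval of existence of the maximally extended solution of `u' = g(u)`, `u(0) = 0`: the
union of all open intervals around `0` on which a solution exists. -/
def maxInterval (g : ℝ → ℝ) : Set ℝ :=
  {t | ∃ (J : Set ℝ) (u : ℝ → ℝ), IsSolutionOn g J u ∧ t ∈ J}

open Classical in
/-- The maximally extended solution of `u' = g(u)`, `u(0) = 0`: at a time `t` of the maximal
interval, the value at `t` of any solution that exists up to time `t` (the value does not depend on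
the choice, see `maxSolution_spec`). Outside the maximal interval the value is meaningless. -/
noncomputable def maxSolution (g : ℝ → ℝ) (t : ℝ) : ℝ :=
  if h : ∃ u : ℝ → ℝ, ∃ J : Set ℝ, IsSolutionOn g J u ∧ t ∈ J then h.choose t else 0

theorem IsSolutionOn.eq_of_mem {g : ℝ → ℝ} (hg : ContDiff ℝ 1 g) {J₁ J₂ : Set ℝ} {u v : ℝ → ℝ}
    (hu : IsSolutionOn g J₁ u) (hv : IsSolutionOn g J₂ v) {t : ℝ} (h₁ : t ∈ J₁) (h₂ : t ∈ J₂) :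
    u t = v t := by
  have hJ : IsOpen (J₁ ∩ J₂) := hu.isOpen.inter hv.isOpen
  have hO : (J₁ ∩ J₂).OrdConnected := hu.ordConnected.inter hv.ordConnected
  have hlo : min 0 t ∈ J₁ ∩ J₂ := by
    rcases min_choice 0 t with h | h <;> rw [h]
    exacts [⟨hu.zero_mem, hv.zero_mem⟩, ⟨h₁, h₂⟩]
  have hhi : max 0 t ∈ J₁ ∩ J₂ := by
    rcases max_choice 0 t with h | h <;> rw [h]
    exacts [⟨hu.zero_mem, hv.zero_mem⟩, ⟨h₁, h₂⟩]
  obtain ⟨a, ha, ha'⟩ := exists_Ioc_subset_of_mem_nhds (hJ.mem_nhds hlo) ⟨min 0 t - 1, by linarith⟩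
  obtain ⟨b, hb, hb'⟩ := exists_Ico_subset_of_mem_nhds (hJ.mem_nhds hhi) ⟨max 0 t + 1, by linarith⟩
  have hsub : Icc ((a + min 0 t) / 2) ((max 0 t + b) / 2) ⊆ J₁ ∩ J₂ :=
    hO.out (ha' ⟨by linarith, by linarith⟩) (hb' ⟨by linarith, by linarith⟩)
  have m0 := min_le_left 0 t
  have mt := min_le_right 0 t
  have M0 := le_max_left 0 t
  have Mt := le_max_right 0 t
  set c := (a + min 0 t) / 2 with hc
  set d := (max 0 t + b) / 2 with hd
  have hcu : ContinuousOn u (Icc c d) := fun s hs =>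
    (hu.hasDerivAt s (hsub hs).1).continuousAt.continuousWithinAt
  have hcv : ContinuousOn v (Icc c d) := fun s hs =>
    (hv.hasDerivAt s (hsub hs).2).continuousAt.continuousWithinAt
  obtain ⟨R, hR⟩ := ((isCompact_Icc.image_of_continuousOn hcu).union
    (isCompact_Icc.image_of_continuousOn hcv)).isBounded.subset_closedBall 0
  obtain ⟨K, hK⟩ := hg.contDiffOn.exists_lipschitzOnWith (s := Metric.closedBall (0 : ℝ) R)
    one_ne_zero (convex_closedBall 0 R) (isCompact_closedBall 0 R)
  have := ODE_solution_unique_of_mem_Ioo (v := fun _ => g) (s := fun _ => Metric.closedBall 0 R)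
    (K := K) (f := u) (g := v) (a := c) (b := d) (t₀ := 0) (fun _ _ => hK)
    ⟨by linarith, by linarith⟩
    (fun s hs => ⟨hu.hasDerivAt s (hsub (Ioo_subset_Icc_self hs)).1,
      hR (Or.inl ⟨s, Ioo_subset_Icc_self hs, rfl⟩)⟩)
    (fun s hs => ⟨hv.hasDerivAt s (hsub (Ioo_subset_Icc_self hs)).2,
      hR (Or.inr ⟨s, Ioo_subset_Icc_self hs, rfl⟩)⟩)
    (by rw [hu.initial, hv.initial])
  exact this ⟨by linarith, by linarith⟩

/-- For continuously differentiable `g`, the function `maxSolution g` agrees with every solution on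
the whole interval where that solution lives; so it is the maximally extended solution. -/
theorem maxSolution_spec {g : ℝ → ℝ} (hg : ContDiff ℝ 1 g) {J : Set ℝ} {u : ℝ → ℝ}
    (hu : IsSolutionOn g J u) : EqOn (maxSolution g) u J := by
  intro t ht
  have h : ∃ u : ℝ → ℝ, ∃ J : Set ℝ, IsSolutionOn g J u ∧ t ∈ J := ⟨u, J, hu, ht⟩
  obtain ⟨J', hJ', ht'⟩ := h.choose_spec
  rw [maxSolution, dif_pos h]
  exact hJ'.eq_of_mem hg hu ht' ht

/-- For continuously differentiable `g`, the function `maxSolution g` is a solution on the interval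
`maxInterval g`, which by its definition contains the interval of every other solution. -/
theorem maxSolution_isSolutionOn {g : ℝ → ℝ} (hg : ContDiff ℝ 1 g) :
    IsSolutionOn g (maxInterval g) (maxSolution g) := by
  obtain ⟨u, hu0, ε, hε, hu⟩ :=
    (hg.contDiffAt (x := (0 : ℝ))).exists_forall_mem_closedBall_exists_eq_forall_mem_Ioo_hasDerivAt₀ 0
  have h₀ : IsSolutionOn g (Ioo (0 - ε) (0 + ε)) u :=
    ⟨isOpen_Ioo, ordConnected_Ioo, ⟨by linarith, by linarith⟩, hu0, hu⟩
  have hU : maxInterval g = ⋃₀ {J | ∃ u, IsSolutionOn g J u} := by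
    ext t
    simp only [maxInterval, mem_ofPred_eq, mem_sUnion]
    exact ⟨fun ⟨J, u, h, ht⟩ => ⟨J, ⟨u, h⟩, ht⟩, fun ⟨J, ⟨u, h⟩, ht⟩ => ⟨J, u, h, ht⟩⟩
  refine ⟨?_, ?_, ⟨_, u, h₀, h₀.zero_mem⟩, ?_, ?_⟩
  · rw [hU]
    exact isOpen_sUnion fun J ⟨u, h⟩ => h.isOpen
  · rw [hU]
    refine (isPreconnected_sUnion 0 _ ?_ ?_).ordConnected
    · rintro J ⟨u, h⟩
      exact h.zero_mem
    · rintro J ⟨u, h⟩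
      exact h.ordConnected.isPreconnected
  · rw [maxSolution_spec hg h₀ h₀.zero_mem, h₀.initial]
  · rintro t ⟨J, v, hv, ht⟩
    rw [maxSolution_spec hg hv ht]
    exact (hv.hasDerivAt t ht).congr_of_eventuallyEq
      ((maxSolution_spec hg hv).eventuallyEq_of_mem (hv.isOpen.mem_nhds ht))

/-- The set `U_max` of all `(h, y)` such that `y ∈ D` and the maximally extended solution of
`w' = F(w, y)`, `w(0) = 0` exists at time `h`. -/
def domain (f : ℝ → ℝ) (D : Set ℝ) (r : ℕ) : Set (ℝ × ℝ) :=
  {p | p.2 ∈ D ∧ p.1 ∈ maxInterval (taylorField f r p.2)}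

/-- The one-step method `Φ(h, y) = y + w(h, y)`, where `w(·, y)` is the maximally extended solution
of `w' = F(w, y)`, `w(0) = 0`. It is meaningful for `(h, y) ∈ domain f D r`. -/
noncomputable def method (f : ℝ → ℝ) (r : ℕ) (h y : ℝ) : ℝ :=
  y + maxSolution (taylorField f r y) h

/-- The values produced by a one-step method: `y_{n+1} = Φ(h, y_n)`. -/
def approx (Φ : ℝ → ℝ → ℝ) (h y₀ : ℝ) : ℕ → ℝ
  | 0 => y₀
  | n + 1 => Φ h (approx Φ h y₀ n)

/-- The one-step method `Φ : U → ℝ` is convergent of order `p` for the approximation of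
`y : [0, T] → D`: for every compact neighbourhood `K ⊆ D` of the trajectory there are `N₀` and `M`
such that for all `N ≥ N₀` and `h = T / N` the values `y_0 = y(0)`, `y_{n+1} = Φ(h, y_n)` are
well-defined for `n ≤ N` (each step evaluates `Φ` inside its domain `U`), stay in the interior
of `K`, and the global error is at most `M * h ^ p`. -/
def IsConvergentOfOrder (Φ : ℝ → ℝ → ℝ) (U : Set (ℝ × ℝ)) (D : Set ℝ) (T : ℝ) (y : ℝ → ℝ)
    (p : ℕ) : Prop :=
  ∀ K : Set ℝ, IsCompact K → K ⊆ D → y '' Icc 0 T ⊆ interior K →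
    ∃ (N₀ : ℕ) (M : ℝ), 0 ≤ M ∧ ∀ N : ℕ, N₀ ≤ N → 0 < N →
      (∀ n < N, (T / N, approx Φ (T / N) (y 0) n) ∈ U) ∧
      (∀ n ≤ N, approx Φ (T / N) (y 0) n ∈ interior K) ∧
      (∀ n ≤ N, |y (n * (T / N)) - approx Φ (T / N) (y 0) n| ≤ M * (T / N) ^ p)

/-- The one-step method `Φ : U → ℝ` is exact for `y : [0, T] → ℝ`: a step of any length `h ≥ 0`
from a point of the trajectory is defined and stays on the trajectory as long as `t + h ≤ T`, and
consequently, for every step size, all computed values are defined and have no error. -/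
def IsExact (Φ : ℝ → ℝ → ℝ) (U : Set (ℝ × ℝ)) (T : ℝ) (y : ℝ → ℝ) : Prop :=
  (∀ t h : ℝ, 0 ≤ t → 0 ≤ h → t + h ≤ T → (h, y t) ∈ U ∧ Φ h (y t) = y (t + h)) ∧
  (∀ (h : ℝ) (n : ℕ), 0 ≤ h → n * h ≤ T →
    (∀ m < n, (h, approx Φ h (y 0) m) ∈ U) ∧ approx Φ h (y 0) n = y (n * h))

end TaylorMethod

/-!
The method takes, from the current value `x₀`, a step along the exact flow of the Taylor polynomial
of `f` at `x₀`.

*Convergence.* Let `u` be the solution of `u' = F(u, x₀)`, `u(0) = 0`, with `F = taylorField`. As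
long as `|u| ≤ m h`, the curve `x₀ + u` solves `x' = f(x)` up to the Taylor remainder, which is at
most `C (m h) ^ (r + 1)` (`exists_taylorField_remainder_le`). Hence Grönwall's inequality compares
it with the trajectory over one step (`abs_sub_method_le`), and since the Grönwall bound is a
semigroup in time (`gronwallBound_add`), the error after `n` steps is at most the Grönwall bound at
time `n h` with initial error `0`, which is linear in the defect and so `O(h ^ (r + 1))`. All
constants are taken on one compact interval that contains the range of the trajectory with a margin
`2δ`. For small `h` the error is below `δ`, so the computed values keep a distance of at least `δ`
from the ends of this interval, and the curves `x₀ + u` with `|u| ≤ δ` stay inside it. The solution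
`u` exists and satisfies `|u t| ≤ m |t| ≤ δ` up to a time that is the same for all steps
(`exists_isSolutionOn_of_abs_le`).

*Exactness.* If `f` is a polynomial of degree at most `r`, then `F(w, x₀) = f(x₀ + w)`
(`taylorField_eq_eval`), so that `s ↦ y(t + s) - y(t)` solves the equation of the method. The
maximal solution is defined through open intervals, so the trajectory is first extended beyond both
ends of `[0, T]` (`exists_hasDerivAt_extension_of_Icc`).
-/

open Set Filter Topology

namespace TaylorMethod

/-! ### The Taylor field and its remainder -/

theorem contDiff_taylorField (f : ℝ → ℝ) (r : ℕ) (y : ℝ) {n : WithTop ℕ∞} :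
    ContDiff ℝ n (taylorField f r y) := by
  unfold taylorField
  fun_prop

theorem continuousOn_taylorField {f : ℝ → ℝ} {D : Set ℝ} {r : ℕ} (hD : IsOpen D)
    (hf : ContDiffOn ℝ (r + 1) f D) :
    ContinuousOn (fun p : ℝ × ℝ => taylorField f r p.1 p.2) (D ×ˢ univ) := by
  unfold taylorField
  refine continuousOn_finsetSum _ fun j hj => ?_
  have hj' : (j : WithTop ℕ∞) ≤ r + 1 := by
    have : j ≤ r + 1 := (Finset.mem_range.1 hj).le
    exact_mod_cast this
  have h : ContinuousOn (iteratedDeriv j f) D :=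
    (hf.continuousOn_iteratedDerivWithin hj' hD.uniqueDiffOn).congr
      fun x hx => (iteratedDerivWithin_of_isOpen hD hx).symm
  exact ((h.comp continuousOn_fst fun p hp => hp.1).div_const _).mul
    (continuousOn_snd.pow j)

/-- The remainder of the Taylor polynomial of order `r` is bounded uniformly in the centre, on both
sides of it. -/
theorem exists_taylorField_remainder_le {f : ℝ → ℝ} {D : Set ℝ} {r : ℕ} (hD : IsOpen D)
    (hf : ContDiffOn ℝ (r + 1) f D) {a b : ℝ} (hab : Icc a b ⊆ D) :
    ∃ C : ℝ, 0 ≤ C ∧ ∀ y ∈ Icc a b, ∀ x ∈ Icc a b,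
      |f x - taylorField f r y (x - y)| ≤ C * |x - y| ^ (r + 1) := by
  have hcont : ContinuousOn (iteratedDeriv (r + 1) f) (Icc a b) :=
    ((hf.continuousOn_iteratedDerivWithin (m := r + 1) (by norm_cast) hD.uniqueDiffOn).congr
      fun x hx => (iteratedDerivWithin_of_isOpen hD hx).symm).mono hab
  obtain ⟨C, hC⟩ := isCompact_Icc.exists_bound_of_continuousOn hcont
  refine ⟨|C|, abs_nonneg C, fun y hy x hx => ?_⟩
  rcases eq_or_ne y x with rfl | hne
  · simp [taylorField, Finset.sum_range_succ']
  have hsub : uIcc y x ⊆ Icc a b := uIcc_subset_Icc hy hx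
  have huniq : UniqueDiffOn ℝ (uIcc y x) := uniqueDiffOn_Icc (min_lt_max.2 hne)
  obtain ⟨c, hc, h⟩ :=
    taylor_mean_remainder_lagrange_iteratedDeriv hne (hf.mono (hsub.trans hab))
  have htay : taylorWithinEval f r (uIcc y x) y x = taylorField f r y (x - y) := by
    rw [taylor_within_apply, taylorField]
    refine Finset.sum_congr rfl fun j hj => ?_
    have hj' : (j : WithTop ℕ∞) ≤ r + 1 := by
      have : j ≤ r + 1 := (Finset.mem_range.1 hj).le
      exact_mod_cast this
    rw [iteratedDerivWithin_eq_iteratedDeriv huniq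
      ((hf.contDiffAt (hD.mem_nhds (hab hy))).of_le hj') left_mem_uIcc, smul_eq_mul]
    ring
  rw [← htay, h, abs_div, abs_mul, abs_pow, Nat.abs_cast]
  have h1 : |iteratedDeriv (r + 1) f c| ≤ |C| :=
    (hC c (hsub (uIoo_subset_uIcc_self hc))).trans (le_abs_self C)
  have h2 : (1 : ℝ) ≤ ((r + 1).factorial : ℝ) := by exact_mod_cast (r + 1).factorial_pos
  calc |iteratedDeriv (r + 1) f c| * |x - y| ^ (r + 1) / ((r + 1).factorial : ℝ)
      ≤ |iteratedDeriv (r + 1) f c| * |x - y| ^ (r + 1) := div_le_self (by positivity) h2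
    _ ≤ |C| * |x - y| ^ (r + 1) := by gcongr

/-! ### Existence with a quantitative time -/

/-- A solution of `u' = g(u)`, `u(0) = 0` exists on `(-τ, τ)` and moves with speed at most `m`,
where `m` bounds `|g|` on `[-δ, δ]` and `m τ ≤ δ`. The time `τ` depends on `g` only through `m`. -/
theorem exists_isSolutionOn_of_abs_le {g : ℝ → ℝ} (hg : ContDiff ℝ 1 g) {δ m τ : ℝ}
    (hδ : 0 ≤ δ) (hm : 0 ≤ m) (hτ : 0 < τ) (hmτ : m * τ ≤ δ)
    (hb : ∀ w ∈ Icc (-δ) δ, |g w| ≤ m) :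
    ∃ u, IsSolutionOn g (Ioo (-τ) τ) u ∧ ∀ t ∈ Ioo (-τ) τ, |u t| ≤ m * |t| := by
  have hδδ : -δ ≤ δ := by linarith
  have hball : Metric.closedBall (0 : ℝ) δ = Icc (-δ) δ := by simp [Real.closedBall_eq_Icc]
  obtain ⟨K, hK⟩ := hg.contDiffOn.exists_lipschitzOnWith (s := Icc (-δ) δ)
    one_ne_zero (convex_Icc _ _) isCompact_Icc
  -- Composing with the projection onto `[-δ, δ]` makes the bound `m` hold globally, which keeps
  -- the solution inside `[-δ, δ]`, where the modified field is `g`.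
  set G : ℝ → ℝ := fun w => g (projIcc (-δ) δ hδδ w) with hG
  have hGm : ∀ w, |G w| ≤ m := fun w => hb _ (projIcc (-δ) δ hδδ w).2
  have hGg : ∀ w ∈ Icc (-δ) δ, G w = g w := fun w hw => by simp [hG, projIcc_of_mem hδδ hw]
  have hPL : IsPicardLindelof (fun _ => G) (tmin := -τ) (tmax := τ)
      ⟨0, by constructor <;> linarith⟩ 0 (.mk δ hδ) 0 (.mk m hm) K := by
    refine IsPicardLindelof.of_time_independent (fun w _ => hGm w) ?_ ?_
    · rw [NNReal.coe_mk, hball]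
      intro v hv w hw
      rw [hGg v hv, hGg w hw]
      exact hK hv hw
    · simpa using hmτ
  obtain ⟨u, hu0, hu⟩ := hPL.exists_eq_forall_mem_Icc_hasDerivWithinAt₀
  have hu0' : u 0 = 0 := hu0
  have hbound : ∀ t ∈ Icc (-τ) τ, |u t| ≤ m * |t| := fun t ht => by
    simpa [hu0'] using (convex_Icc (-τ) τ).norm_image_sub_le_of_norm_hasDerivWithin_le hu
      (fun s _ => hGm (u s)) (x := 0) ⟨by linarith, hτ.le⟩ ht
  refine ⟨u, ⟨isOpen_Ioo, ordConnected_Ioo, ⟨by linarith, hτ⟩, hu0', fun t ht => ?_⟩,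
    fun t ht => hbound t (Ioo_subset_Icc_self ht)⟩
  have hut : u t ∈ Icc (-δ) δ := by
    refine abs_le.1 ((hbound t (Ioo_subset_Icc_self ht)).trans (le_trans ?_ hmτ))
    gcongr
    exact (abs_lt.2 ht).le
  rw [← hGg _ hut]
  exact (hu t (Ioo_subset_Icc_self ht)).hasDerivAt (Icc_mem_nhds ht.1 ht.2)

/-! ### Convergence -/

theorem gronwallBound_add (δ K ε s t : ℝ) :
    gronwallBound (gronwallBound δ K ε s) K ε t = gronwallBound δ K ε (s + t) := by
  rcases eq_or_ne K 0 with rfl | hK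
  · simp only [gronwallBound_K0]
    ring
  · simp only [gronwallBound_of_K_ne_0 hK, mul_add, Real.exp_add]
    ring

theorem gronwallBound_zero_left (K ε t : ℝ) :
    gronwallBound 0 K ε t = ε * gronwallBound 0 K 1 t := by
  rcases eq_or_ne K 0 with rfl | hK
  · simp [gronwallBound_K0]
  · simp only [gronwallBound_of_K_ne_0 hK]
    ring

/-- One step of the method compared with a solution `z` of `z' = f(z)`: an error of at most `e` at
time `t₀` becomes at most the Grönwall bound with initial value `e` and defect
`C * (m * h) ^ (r + 1)`. The interval `[a, b]` contains the `δ`-neighbourhood of `x₀`. -/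
theorem abs_sub_method_le {f : ℝ → ℝ} {r : ℕ} {a b δ m τ C h t₀ e x₀ : ℝ} {K : NNReal}
    {z : ℝ → ℝ} (hf : LipschitzOnWith K f (Icc a b)) (hC : 0 ≤ C)
    (hrem : ∀ y ∈ Icc a b, ∀ x ∈ Icc a b,
      |f x - taylorField f r y (x - y)| ≤ C * |x - y| ^ (r + 1))
    (hδ : 0 ≤ δ) (hm : 0 ≤ m) (hτ : 0 < τ) (hmτ : m * τ ≤ δ)
    (hx₀ : x₀ ∈ Icc (a + δ) (b - δ)) (hb : ∀ w ∈ Icc (-δ) δ, |taylorField f r x₀ w| ≤ m)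
    (hh : 0 ≤ h) (hhτ : h < τ)
    (hz : ∀ t ∈ Icc t₀ (t₀ + h), HasDerivWithinAt z (f (z t)) (Icc t₀ (t₀ + h)) t)
    (hzab : ∀ t ∈ Icc t₀ (t₀ + h), z t ∈ Icc a b) (he : |z t₀ - x₀| ≤ e) :
    h ∈ maxInterval (taylorField f r x₀) ∧
      |z (t₀ + h) - method f r h x₀| ≤ gronwallBound e K (C * (m * h) ^ (r + 1)) h := by
  have hg := contDiff_taylorField f r x₀ (n := 1)
  obtain ⟨u, hu, hub⟩ := exists_isSolutionOn_of_abs_le hg hδ hm hτ hmτ hb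
  have hhI : h ∈ Ioo (-τ) τ := ⟨by linarith, hhτ⟩
  refine ⟨⟨_, u, hu, hhI⟩, ?_⟩
  rw [method, maxSolution_spec hg hu hhI]
  have hmem : ∀ t ∈ Icc t₀ (t₀ + h), t - t₀ ∈ Ioo (-τ) τ := fun t ht =>
    ⟨by linarith [ht.1], by linarith [ht.2]⟩
  have hd : ∀ t ∈ Icc t₀ (t₀ + h), HasDerivAt (fun s => x₀ + u (s - t₀))
      (taylorField f r x₀ (u (t - t₀))) t := fun t ht =>
    ((hu.hasDerivAt _ (hmem t ht)).comp_sub_const t t₀).const_add x₀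
  have hut : ∀ t ∈ Icc t₀ (t₀ + h), |u (t - t₀)| ≤ m * h := fun t ht =>
    (hub _ (hmem t ht)).trans <| by
      rw [abs_of_nonneg (by linarith [ht.1])]
      gcongr
      linarith [ht.2]
  have hxab : x₀ ∈ Icc a b := ⟨by linarith [hx₀.1], by linarith [hx₀.2]⟩
  have huab : ∀ t ∈ Icc t₀ (t₀ + h), x₀ + u (t - t₀) ∈ Icc a b := fun t ht => by
    have h1 : |u (t - t₀)| ≤ δ := (hut t ht).trans <| le_trans (by gcongr) hmτ
    have := abs_le.1 h1
    exact ⟨by linarith [hx₀.1], by linarith [hx₀.2]⟩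
  have key := dist_le_of_approx_trajectories_ODE_of_mem (v := fun _ => f) (K := K)
    (s := fun _ => Icc a b) (f := z) (f' := fun t => f (z t)) (εf := 0)
    (g := fun t => x₀ + u (t - t₀)) (g' := fun t => taylorField f r x₀ (u (t - t₀)))
    (εg := C * (m * h) ^ (r + 1)) (a := t₀) (b := t₀ + h) (δ := e)
    (fun _ _ => hf) (fun t ht => (hz t ht).continuousWithinAt)
    (fun t ht => (hz t (Ico_subset_Icc_self ht)).mono_of_mem_nhdsWithin
      (mem_of_superset (Ico_mem_nhdsGE ht.2)
        (Ico_subset_Icc_self.trans (Icc_subset_Icc_left ht.1))))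
    (fun t _ => by simp) (fun t ht => hzab t (Ico_subset_Icc_self ht))
    (fun t ht => (hd t ht).continuousAt.continuousWithinAt)
    (fun t ht => (hd t (Ico_subset_Icc_self ht)).hasDerivWithinAt)
    (fun t ht => by
      have ht' := Ico_subset_Icc_self ht
      have := hrem x₀ hxab _ (huab t ht')
      rw [add_sub_cancel_left] at this
      rw [dist_comm, Real.dist_eq]
      refine this.trans ?_
      gcongr
      exact hut t ht')
    (fun t ht => huab t (Ico_subset_Icc_self ht))
    (by simpa [Real.dist_eq, hu.initial] using he) (t₀ + h) ⟨by linarith, le_rfl⟩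
  simpa [Real.dist_eq] using key

theorem isConvergentOfOrder_method {r : ℕ} {D : Set ℝ} (hD : IsOpen D) {f : ℝ → ℝ}
    (hf : ContDiffOn ℝ (r + 1) f D) {T : ℝ} (hT : 0 < T) {y : ℝ → ℝ}
    (hy : ∀ t ∈ Icc 0 T, HasDerivWithinAt y (f (y t)) (Icc 0 T) t) :
    IsConvergentOfOrder (method f r) (domain f D r) D T y (r + 1) := by
  intro K _ hKD hyK
  have hycont : ContinuousOn y (Icc 0 T) := fun t ht => (hy t ht).continuousWithinAt
  have himc : IsCompact (y '' Icc 0 T) := isCompact_Icc.image_of_continuousOn hycont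
  obtain ⟨a, b, himage⟩ : ∃ a b, y '' Icc 0 T = Icc a b :=
    ⟨_, _, eq_Icc_of_connected_compact
      ((isConnected_Icc hT.le).image y hycont) himc⟩
  have hyab : ∀ t ∈ Icc 0 T, y t ∈ Icc a b := fun t ht => himage ▸ mem_image_of_mem y ht
  obtain ⟨ρ, hρ, hρK⟩ := himc.exists_cthickening_subset_open isOpen_interior hyK
  obtain ⟨δ, rfl⟩ : ∃ δ, ρ = 2 * δ := ⟨ρ / 2, by ring⟩
  have hδ : 0 < δ := by linarith
  have hab : a ≤ b := (hyab 0 ⟨le_rfl, hT.le⟩).1.trans (hyab 0 ⟨le_rfl, hT.le⟩).2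
  have hsub : Icc (a - 2 * δ) (b + 2 * δ) ⊆ interior K := fun x hx => by
    refine hρK (Metric.mem_cthickening_of_dist_le x (projIcc a b hab x) _ _
      (himage.symm.subset (projIcc a b hab x).2) ?_)
    rw [coe_projIcc, Real.dist_eq, abs_le]
    have := hx.1
    have := hx.2
    constructor <;> rcases max_cases a (min b x) with h | h <;>
      rcases min_cases b x with h' | h' <;> linarith
  have hsubD : Icc (a - 2 * δ) (b + 2 * δ) ⊆ D := hsub.trans (interior_subset.trans hKD)
  obtain ⟨L, hL⟩ := (hf.mono hsubD).exists_lipschitzOnWith (by simp)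
    (convex_Icc _ _) isCompact_Icc
  obtain ⟨C, hC, hrem⟩ := exists_taylorField_remainder_le hD hf hsubD
  obtain ⟨m, hm, hmb⟩ : ∃ m : ℝ, 0 < m ∧ ∀ x ∈ Icc (a - 2 * δ) (b + 2 * δ),
      ∀ w ∈ Icc (-δ) δ, |taylorField f r x w| ≤ m := by
    obtain ⟨m, hm⟩ := (isCompact_Icc.prod isCompact_Icc).exists_bound_of_continuousOn
      ((continuousOn_taylorField hD hf).mono
        (prod_mono hsubD (subset_univ (Icc (-δ) δ))))
    exact ⟨|m| + 1, by positivity, fun x hx w hw =>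
      (hm (x, w) ⟨hx, hw⟩).trans ((le_abs_self m).trans (by linarith))⟩
  have hG : 0 ≤ gronwallBound 0 L 1 T := by
    simpa [gronwallBound_x0] using
      gronwallBound_mono (le_refl (0 : ℝ)) zero_le_one L.coe_nonneg hT.le
  -- The bound at time `T` for the defect `C * (m * h) ^ (r + 1)` is `M * h ^ (r + 1)`.
  set M : ℝ := C * m ^ (r + 1) * gronwallBound 0 L 1 T with hM
  have hM0 : 0 ≤ M := by positivity
  -- The time `δ / m` is the guaranteed lifetime of a step; the second condition keeps the computed
  -- values within `δ` of the trajectory.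
  have hsmall : ∀ᶠ h : ℝ in 𝓝 0, h < δ / m ∧ M * h ^ (r + 1) < δ :=
    (eventually_lt_nhds (div_pos hδ hm)).and
      ((show ContinuousAt (fun h : ℝ => M * h ^ (r + 1)) 0 by fun_prop).eventually_lt_const
        (by simpa using hδ))
  obtain ⟨N₀, hN₀⟩ := eventually_atTop.1
    ((tendsto_const_div_atTop_nhds_zero_nat T).eventually hsmall)
  refine ⟨N₀, M, hM0, fun N hN hNpos => ?_⟩
  obtain ⟨hhτ, hhδ⟩ := hN₀ N hN
  have hNR : (0 : ℝ) < N := by exact_mod_cast hNpos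
  have hNh : N * (T / N) = T := by field_simp
  have hh : 0 < T / N := div_pos hT hNR
  set h : ℝ := T / N
  set x : ℕ → ℝ := approx (method f r) h (y 0) with hx
  have htime : ∀ n ≤ N, (n : ℝ) * h ∈ Icc 0 T := fun n hn =>
    ⟨by positivity, by rw [← hNh]; gcongr⟩
  have hglobal : ∀ n ≤ N, ∀ e, e ≤ gronwallBound 0 L (C * (m * h) ^ (r + 1)) (n * h) →
      e ≤ M * h ^ (r + 1) := fun n hn e he => by
    refine he.trans ((gronwallBound_mono le_rfl (by positivity) L.coe_nonneg
      (htime n hn).2).trans ?_)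
    rw [gronwallBound_zero_left, hM, mul_pow]
    exact le_of_eq (by ring)
  have hnear : ∀ n ≤ N, |y (n * h) - x n| ≤ M * h ^ (r + 1) →
      x n ∈ Icc (a - 2 * δ + δ) (b + 2 * δ - δ) := fun n hn he => by
    have h1 := abs_le.1 (he.trans hhδ.le)
    have h2 := hyab _ (htime n hn)
    exact ⟨by linarith [h1.2, h2.1], by linarith [h1.1, h2.2]⟩
  have hstep : ∀ n < N, |y (n * h) - x n| ≤ gronwallBound 0 L (C * (m * h) ^ (r + 1)) (n * h) →
      h ∈ maxInterval (taylorField f r (x n)) ∧ |y ((n + 1 : ℕ) * h) - x (n + 1)| ≤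
        gronwallBound 0 L (C * (m * h) ^ (r + 1)) ((n + 1 : ℕ) * h) := fun n hn he => by
    have hxn := hnear n hn.le (hglobal n hn.le _ he)
    have hnext : ((n + 1 : ℕ) : ℝ) * h = n * h + h := by push_cast; ring
    have hIcc : Icc (n * h) (n * h + h) ⊆ Icc 0 T :=
      Icc_subset_Icc (htime n hn.le).1 (hnext ▸ (htime (n + 1) hn).2)
    have := abs_sub_method_le hL hC hrem hδ.le hm.le (div_pos hδ hm)
      (mul_div_cancel₀ δ hm.ne').le hxn
      (hmb _ ⟨by linarith [hxn.1], by linarith [hxn.2]⟩) hh.le hhτ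
      (fun t ht => (hy t (hIcc ht)).mono hIcc)
      (fun t ht => Icc_subset_Icc (by linarith) (by linarith) (hyab t (hIcc ht))) he
    rwa [gronwallBound_add, ← hnext] at this
  have herr : ∀ n ≤ N,
      |y (n * h) - x n| ≤ gronwallBound 0 L (C * (m * h) ^ (r + 1)) (n * h) := by
    intro n
    induction n with
    | zero => simp [hx, approx, gronwallBound_x0]
    | succ n ih => exact fun hn => (hstep n hn (ih (Nat.le_of_succ_le hn))).2
  have hxK : ∀ n ≤ N, x n ∈ interior K := fun n hn => by
    have := hnear n hn (hglobal n hn _ (herr n hn))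
    exact hsub ⟨by linarith [this.1], by linarith [this.2]⟩
  exact ⟨fun n hn => ⟨hKD (interior_subset (hxK n hn.le)), (hstep n hn (herr n hn.le)).1⟩,
    hxK, fun n hn => hglobal n hn _ (herr n hn)⟩

/-! ### Exactness for polynomial vector fields -/

theorem taylorField_eq_eval {f : ℝ → ℝ} {D : Set ℝ} (hD : IsOpen D) {r : ℕ} {P : Polynomial ℝ}
    (hP : P.natDegree ≤ r) (hfP : ∀ x ∈ D, f x = P.eval x) {y : ℝ} (hy : y ∈ D) (w : ℝ) :
    taylorField f r y w = P.eval (y + w) := by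
  have hderiv : ∀ j, iteratedDeriv j f y = (Polynomial.derivative^[j] P).eval y := fun j => by
    have h1 : iteratedDeriv j f y = iteratedDeriv j (fun x => P.eval x) y :=
      Filter.EventuallyEq.iteratedDeriv_eq j
        (Filter.eventually_of_mem (hD.mem_nhds hy) hfP)
    have h2 : ∀ j, iteratedDeriv j (fun x => P.eval x) =
        fun x => (Polynomial.derivative^[j] P).eval x := fun j => by
      induction j with
      | zero => simp
      | succ j ih =>
        rw [iteratedDeriv_succ, ih, Function.iterate_succ_apply']
        ext x
        exact Polynomial.deriv _
    rw [h1, h2]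
  have hcoeff : ∀ j, iteratedDeriv j f y / (j.factorial : ℝ) = (Polynomial.taylor y P).coeff j :=
    fun j => by
      rw [hderiv, Polynomial.taylor_coeff, ← Polynomial.factorial_smul_hasseDeriv]
      simp [Nat.factorial_ne_zero]
  rw [add_comm, ← Polynomial.taylor_eval, Polynomial.eval_eq_sum_range'
    (n := r + 1) (by rw [Polynomial.natDegree_taylor]; omega), taylorField]
  exact Finset.sum_congr rfl fun j _ => by rw [hcoeff]

/-- A solution of an autonomous equation on a compact interval, with one-sided derivatives at the
ends, extends to a solution on an open interval. -/
theorem exists_hasDerivAt_extension_of_Icc {g : ℝ → ℝ} (hg : ContDiff ℝ 1 g) {a b : ℝ}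
    (hab : a ≤ b) {z : ℝ → ℝ}
    (hz : ∀ t ∈ Icc a b, HasDerivWithinAt z (g (z t)) (Icc a b) t) :
    ∃ ε > 0, ∃ Z : ℝ → ℝ, EqOn Z z (Icc a b) ∧
      ∀ t ∈ Ioo (a - ε) (b + ε), HasDerivAt Z (g (Z t)) t := by
  obtain ⟨u, hua, ε₁, hε₁, hu⟩ := (hg.contDiffAt
    (x := z a)).exists_forall_mem_closedBall_exists_eq_forall_mem_Ioo_hasDerivAt₀ a
  obtain ⟨v, hvb, ε₂, hε₂, hv⟩ := (hg.contDiffAt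
    (x := z b)).exists_forall_mem_closedBall_exists_eq_forall_mem_Ioo_hasDerivAt₀ b
  set Z : ℝ → ℝ := fun t => if t < a then u t else if t ≤ b then z t else v t with hZ
  have hmid : EqOn Z z (Icc a b) := fun t ht => by simp [hZ, ht.1.not_gt, ht.2]
  have hleft : EqOn Z u (Iic a) := fun t (ht : t ≤ a) => by
    rcases ht.eq_or_lt with rfl | h
    · rw [hmid ⟨le_rfl, hab⟩, hua]
    · simp [hZ, h]
  have hright : EqOn Z v (Ici b) := fun t (ht : b ≤ t) => by
    rcases ht.eq_or_lt with rfl | h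
    · rw [hmid ⟨hab, le_rfl⟩, hvb]
    · simp [hZ, (hab.trans ht).not_gt, h.not_ge]
  refine ⟨min ε₁ ε₂, lt_min hε₁ hε₂, Z, hmid, fun t ht => ?_⟩
  have h₁ : a - ε₁ < t := by linarith [ht.1, min_le_left ε₁ ε₂]
  have h₂ : t < b + ε₂ := by linarith [ht.2, min_le_right ε₁ ε₂]
  -- The line is covered by three closed sets, and on each of them `Z` is a solution; a set that
  -- does not contain `t` imposes no condition at `t`.
  have hpiece : ∀ (S : Set ℝ) (w : ℝ → ℝ), IsClosed S → EqOn Z w S →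
      (t ∈ S → HasDerivWithinAt w (g (w t)) S t) → HasDerivWithinAt Z (g (Z t)) S t := by
    intro S w hS hw hd
    by_cases htS : t ∈ S
    · rw [hw htS]
      exact (hd htS).congr_of_mem hw htS
    · exact HasFDerivWithinAt.of_notMem_closure (by rwa [hS.closure_eq])
  have hcover : Iic a ∪ Icc a b ∪ Ici b = univ := by
    rw [Iic_union_Icc_eq_Iic hab, Iic_union_Ici]
  rw [← hasDerivWithinAt_univ, ← hcover]
  exact ((hpiece _ u isClosed_Iic hleft fun h =>
      (hu t ⟨h₁, by linarith [mem_Iic.1 h]⟩).hasDerivWithinAt).union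
    (hpiece _ z isClosed_Icc hmid (hz t))).union
    (hpiece _ v isClosed_Ici hright fun h =>
      (hv t ⟨by linarith [mem_Ici.1 h], h₂⟩).hasDerivWithinAt)

theorem isExact_method_of_eq_eval {r : ℕ} {D : Set ℝ} (hD : IsOpen D) {f : ℝ → ℝ} {T : ℝ}
    {y : ℝ → ℝ} (hyD : ∀ t ∈ Icc 0 T, y t ∈ D)
    (hy : ∀ t ∈ Icc 0 T, HasDerivWithinAt y (f (y t)) (Icc 0 T) t) {P : Polynomial ℝ}
    (hP : P.natDegree ≤ r) (hfP : ∀ x ∈ D, f x = P.eval x) :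
    IsExact (method f r) (domain f D r) T y := by
  have hstep : ∀ t h : ℝ, 0 ≤ t → 0 ≤ h → t + h ≤ T →
      (h, y t) ∈ domain f D r ∧ method f r h (y t) = y (t + h) := by
    intro t h ht hh hth
    have hT : 0 ≤ T := by linarith
    have htT : t ∈ Icc 0 T := ⟨ht, by linarith⟩
    have htD := hyD t htT
    obtain ⟨ε, hε, Z, hZy, hZ⟩ := exists_hasDerivAt_extension_of_Icc
      (g := fun x => P.eval x) (by simpa using P.contDiff_aeval (𝕜 := ℝ) 1) hT
      fun s hs => hfP _ (hyD s hs) ▸ hy s hs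
    have hg := contDiff_taylorField f r (y t) (n := 1)
    have hu : IsSolutionOn (taylorField f r (y t)) (Ioo (0 - ε - t) (T + ε - t))
        (fun s => Z (t + s) - y t) := by
      refine ⟨isOpen_Ioo, ordConnected_Ioo, ⟨by linarith, by linarith⟩, ?_, fun s hs => ?_⟩
      · simp [hZy htT]
      · rw [taylorField_eq_eval hD hP hfP htD, add_sub_cancel]
        exact ((hZ (t + s) ⟨by linarith [hs.1], by linarith [hs.2]⟩).comp_const_add t s).sub_const
          (y t)
    have hhI : h ∈ Ioo (0 - ε - t) (T + ε - t) := ⟨by linarith, by linarith⟩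
    refine ⟨⟨htD, _, _, hu, hhI⟩, ?_⟩
    rw [method, maxSolution_spec hg hu hhI, add_sub_cancel, hZy ⟨by linarith, hth⟩]
  refine ⟨hstep, fun h n hh => ?_⟩
  induction n with
  | zero => simp [approx]
  | succ n ih =>
    intro hn
    have hsucc : ((n + 1 : ℕ) : ℝ) * h = n * h + h := by push_cast; ring
    rw [hsucc] at hn
    obtain ⟨hdom, heq⟩ := ih (by linarith)
    obtain ⟨hmem, hval⟩ := hstep (n * h) h (by positivity) hh hn
    refine ⟨fun k hk => ?_, by rw [approx, heq, hval, hsucc]⟩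
    rcases (Nat.lt_succ_iff.1 hk).eq_or_lt with rfl | hk'
    · rwa [heq]
    · exact hdom k hk'

end TaylorMethod

open TaylorMethod in
theorem theorem2p3 (r : ℕ) (D : Set ℝ) (hD : IsOpen D) (f : ℝ → ℝ)
    (hf : ContDiffOn ℝ (r + 1) f D) (T : ℝ) (hT : 0 < T) (y : ℝ → ℝ)
    (hyD : ∀ t ∈ Set.Icc 0 T, y t ∈ D)
    (hy : ∀ t ∈ Set.Icc 0 T, HasDerivWithinAt y (f (y t)) (Set.Icc 0 T) t) :
    IsConvergentOfOrder (method f r) (domain f D r) D T y (r + 1) ∧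
    (∀ P : Polynomial ℝ, P.natDegree ≤ r → (∀ x ∈ D, f x = P.eval x) →
      IsExact (method f r) (domain f D r) T y) ∧
    (r = 2 → ∀ a b c : ℝ, (∀ x ∈ D, f x = a * x ^ 2 + b * x + c) →
      IsExact (method f r) (domain f D r) T y) := by
  refine ⟨isConvergentOfOrder_method hD hf hT hy,
    fun P hP hfP => isExact_method_of_eq_eval hD hyD hy hP hfP, ?_⟩
  rintro rfl a b c hfabc
  refine isExact_method_of_eq_eval hD hyD hy
    (P := Polynomial.C a * Polynomial.X ^ 2 + Polynomial.C b * Polynomial.X + Polynomial.C c)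
    Polynomial.natDegree_quadratic_le fun x hx => ?_
  simpa using hfabc x hx
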